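/- All lattices are finite. For a semidistributive lattice $L$ and $x\in L$, let $D(x)$ be the set of all elements $\min\{z\in L : z\le x,\ z\not\le y\}$, where $y$ runs over the elements covered by $x$. The canonical join complex of $L$ is the simplicial complex $\{D(x) : x\in L\}$; its $1$-skeleton is the canonical join graph of $L$. A lattice is extremal if its length, its number of join-irreducible elements and its number of meet-irreducible elements are equal. The Grötzsch graph is the Mycielskian of the $5$-cycle. (1) An induced subcomplex of a canonical join complex of a semidistributive lattice need not be (isomorphic to) a canonical join complex of a semidistributive lattice, even if the initial lattice is extremal. Explicitly, let $G$ be the directed graph with vertices $v_0,\dots,v_4,u_0,\dots,u_4,w,t$ and with arrows $u_i\to v_{i-1}$, $u_i\to v_{i+1}$, $u_i\to w$ for $i\in\mathbb Z/5$, and $v_1\to v_0$, $v_2\to v_1$, $v_2\to v_3$, $v_4\to v_3$, $v_4\to v_0$, $v_2\to t$, $t\to v_1$. Let $L$ be the lattice of maximal orthogonal pairs of $G$, i.e. of the pairs $(X,Y)$ of disjoint sets of vertices of $G$ without arrows from $X$ to $Y$ that are maximal for this condition, ordered by inclusion of the first components. Then $L$ is a semidistributive extremal lattice with $168$ elements,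 and its canonical join complex has a vertex such that the induced subcomplex $K$ on all the other vertices has the following properties: the $1$-skeleton of $K$ is isomorphic to the complement of the Grötzsch graph, this $1$-skeleton is not isomorphic to the canonical join graph of any semidistributive lattice, and $K$ is not isomorphic to the canonical join complex of any semidistributive lattice. (2) In a directed graph with a loop at every vertex, write $x\hookrightarrow y$ if $x\to y$ and, for all $z$, $z\to x$ implies $z\to y$; write $x\twoheadrightarrow y$ if $x\to y$ and, for all $z$, $y\to z$ implies $x\to z$. The directed graph forms a two-acyclic factorization system if for all $x\ne y$ none of $x\twoheadrightarrow y\twoheadrightarrow x$, $x\hookrightarrow y\hookrightarrow x$, $x\twoheadrightarrow y\hookrightarrow x$ holds, and for all $x\to z$ there is $y$ with $x\twoheadrightarrow y\hookrightarrow z$. A simple graph admits a two-acyclic factorization system if its edges can be oriented so that, after adding a loop at every vertex, the resulting directed graph forms one. Then a triangle-free simple graph admits a two-acyclic factorization system if and only if its chromatic number is at most $3$. -/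

import Mathlib

universe u v

namespace PreAbstractSimplicialComplex

/-- The vertices of a simplicial complex: the points that are themselves faces. -/
def vertexSet {α : Type*} (K : PreAbstractSimplicialComplex α) : Set α :=
  {a | {a} ∈ K.faces}

/-- The induced subcomplex of `K` on `X`: all the faces of `K` that are contained in `X`. -/
def induce {α : Type*} (K : PreAbstractSimplicialComplex α) (X : Set α) :
    PreAbstractSimplicialComplex α where
  faces := {s | s ∈ K.faces ∧ (s : Set α) ⊆ X}
  isRelLowerSet_faces := by
    rintro s ⟨hs, hX⟩
    refine ⟨(K.isRelLowerSet_faces hs).1, fun t hts ht => ?_⟩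
    exact ⟨(K.isRelLowerSet_faces hs).2 hts ht, fun a ha => hX (hts ha)⟩

/-- Two simplicial complexes are isomorphic if there is a bijection between their vertices that
identifies their faces. -/
def Isomorphic {α β : Type*} (K : PreAbstractSimplicialComplex α)
    (K' : PreAbstractSimplicialComplex β) : Prop :=
  ∃ e : K.vertexSet ≃ K'.vertexSet, ∀ s : Finset K.vertexSet,
    s.map (Function.Embedding.subtype _) ∈ K.faces ↔
      (s.map e.toEmbedding).map (Function.Embedding.subtype _) ∈ K'.faces

/-- The 1-skeleton of a simplicial complex, as a simple graph on its vertices. As the faces are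
closed under nonempty subsets, two distinct vertices lie in a common face if and only if
the pair they form is a face. -/
def oneSkeleton {α : Type*} (K : PreAbstractSimplicialComplex α) : SimpleGraph K.vertexSet where
  Adj a b := a ≠ b ∧ ∃ s ∈ K.faces, (a : α) ∈ s ∧ (b : α) ∈ s
  symm := ⟨fun _ _ ⟨h, s, hs, ha, hb⟩ => ⟨h.symm, s, hs, hb, ha⟩⟩
  loopless := ⟨fun _ h => h.1 rfl⟩

end PreAbstractSimplicialComplex

namespace CanonicalJoin

section Lattices

/-- Join-semidistributive and meet-semidistributive. -/
structure IsSemidistributive (L : Type*) [Lattice L] : Prop where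
  join : ∀ x y z : L, x ⊔ y = x ⊔ z → x ⊔ (y ⊓ z) = x ⊔ y
  meet : ∀ x y z : L, x ⊓ y = x ⊓ z → x ⊓ (y ⊔ z) = x ⊓ y

/-- The join-irreducible elements of a finite lattice: those covering a unique element. -/
def joinIrreducibles (L : Type*) [Lattice L] : Set L := {j | ∃! x, x ⋖ j}

/-- The meet-irreducible elements of a finite lattice: those covered by a unique element. -/
def meetIrreducibles (L : Type*) [Lattice L] : Set L := {m | ∃! x, m ⋖ x}

/-- A finite lattice is extremal if its length (the greatest `n` such that there is a chain of
`n + 1` elements) is both the number of its join-irreducible elements and the number of its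
meet-irreducible elements. -/
structure IsExtremal (L : Type*) [Lattice L] : Prop where
  join : Order.krullDim L = ((joinIrreducibles L).ncard : WithBot ℕ∞)
  meet : Order.krullDim L = ((meetIrreducibles L).ncard : WithBot ℕ∞)

/-- The downward label set of `x`: the labels of the covers `y ⋖ x`, where the label of `y ⋖ x` is
the minimum of the set of elements that are below `x` and not below `y`. -/
def downLabels {L : Type*} [Lattice L] (x : L) : Set L :=
  {j | ∃ y, y ⋖ x ∧ IsLeast {z | z ≤ x ∧ ¬ z ≤ y} j}

/-- A nonempty subset of a downward label set is the downward label set of its join. -/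
theorem eq_downLabels_sup' {L : Type*} [Lattice L] {x : L} (s : Finset L) (hs : s.Nonempty)
    (hsx : (s : Set L) ⊆ downLabels x) : (s : Set L) = downLabels (s.sup' hs id) := by
  have key : ∀ j ∈ s, ∃ c, c ⋖ s.sup' hs id ∧ IsLeast {z | z ≤ s.sup' hs id ∧ ¬ z ≤ c} j := by
    intro j hj
    obtain ⟨y, hyx, ⟨hjx, hjy⟩, hmin⟩ := hsx hj
    have hle : s.sup' hs id ≤ x := by
      refine Finset.sup'_le hs id fun k hk => ?_
      obtain ⟨_, _, ⟨hkx, _⟩, _⟩ := hsx hk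
      exact hkx
    have hjs : j ≤ s.sup' hs id := Finset.le_sup' id hj
    refine ⟨s.sup' hs id ⊓ y, ⟨?_, ?_⟩, ⟨hjs, fun h => hjy (h.trans inf_le_right)⟩, ?_⟩
    · exact lt_of_le_not_ge inf_le_left fun h => hjy (hjs.trans (h.trans inf_le_right))
    · intro d hcd hds
      have hdy : ¬ d ≤ y := fun h => hcd.not_ge (le_inf hds.le h)
      refine hds.not_ge (Finset.sup'_le hs id fun k hk => ?_)
      obtain ⟨y', hyx', ⟨hkx, hky⟩, hmin'⟩ := hsx hk
      by_cases hyy : y = y'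
      · subst hyy
        exact hmin' ⟨hds.le.trans hle, hdy⟩
      · have hky' : k ≤ y := by
          refine hmin' ⟨hyx.le, fun h => ?_⟩
          exact hyx.2 (lt_of_le_of_ne h hyy) hyx'.lt
        exact (le_inf (Finset.le_sup' id hk) hky').trans hcd.le
    · rintro z ⟨hz, hzc⟩
      exact hmin ⟨hz.trans hle, fun h => hzc (le_inf hz h)⟩
  refine Set.Subset.antisymm (fun j hj => key j hj) ?_
  rintro j ⟨c, hc, hj⟩
  obtain ⟨k, hk, hkc⟩ : ∃ k ∈ s, ¬ k ≤ c := by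
    by_contra! h
    exact hc.lt.not_ge (Finset.sup'_le hs id h)
  obtain ⟨c', hc', hk'⟩ := key k hk
  by_cases hcc : c = c'
  · subst hcc
    exact (hj.unique hk') ▸ hk
  · refine absurd (hk'.2 ⟨hc.le, fun h => ?_⟩) hkc
    exact hc.2 (lt_of_le_of_ne h hcc) hc'.lt

/-- The canonical join complex of a (finite semidistributive) lattice: the simplicial complex whose
faces are the nonempty downward label sets. (In Mathlib, simplicial complexes do not
contain the empty face, which is the downward label set of the minimum.) -/
def canonicalJoinComplex (L : Type*) [Lattice L] : PreAbstractSimplicialComplex L where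
  faces := {s | s.Nonempty ∧ ∃ x : L, (s : Set L) = downLabels x}
  isRelLowerSet_faces := by
    rintro s ⟨hs, x, hx⟩
    refine ⟨hs, fun t hts ht => ⟨ht, t.sup' ht id, eq_downLabels_sup' (x := x) t ht ?_⟩⟩
    exact fun a ha => hx ▸ hts ha

/-- `K` is a canonical join complex: up to isomorphism, it is the canonical join complex of a finite
semidistributive lattice. -/
def IsCanonicalJoinComplex {α : Type*} (K : PreAbstractSimplicialComplex α) : Prop :=
  ∃ (M : Type u) (_ : Lattice M), Finite M ∧ IsSemidistributive M ∧
    K.Isomorphic (canonicalJoinComplex M)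

/-- `G` is a canonical join graph: up to isomorphism, it is the 1-skeleton of the canonical join
complex of a finite semidistributive lattice. -/
def IsCanonicalJoinGraph {α : Type*} (G : SimpleGraph α) : Prop :=
  ∃ (M : Type u) (_ : Lattice M), Finite M ∧ IsSemidistributive M ∧
    Nonempty (G ≃g (canonicalJoinComplex M).oneSkeleton)

end Lattices

section Digraphs

/-- The lattice of maximal orthogonal pairs of a directed graph: the pairs `(X, Y)` of disjoint sets
of vertices without arrows from `X` to `Y`, maximal for this condition, and ordered by inclusion of
the first components. These are the formal concepts of the relation
"`x ≠ y` and there is no arrow from `x` to `y`". -/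
abbrev MaximalOrthogonalPairs {V : Type*} (arrow : V → V → Prop) : Type _ :=
  Concept V V (fun x y => x ≠ y ∧ ¬ arrow x y)

/-- The arrows of a directed graph on twelve vertices, which are named
`v₀, …, v₄ = 0, …, 4`, `u₀, …, u₄ = 5, …, 9`, `w = 10` and `t = 11`. -/
def galoisArrows : Finset (Fin 12 × Fin 12) :=
  { (5, 1), (5, 4), (6, 0), (6, 2), (7, 1), (7, 3), (8, 2), (8, 4), (9, 0), (9, 3),
    (5, 10), (6, 10), (7, 10), (8, 10), (9, 10),
    (1, 0), (2, 1), (2, 3), (4, 3), (4, 0),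
    (2, 11), (11, 1) }

/-- The Mycielskian of a simple graph: to the graph `G` on `v`'s one adds a vertex `u_i` for each
vertex `v_i`, adjacent to the neighbours of `v_i`, and a vertex adjacent to all the `u_i`. -/
def mycielskian {V : Type*} (G : SimpleGraph V) : SimpleGraph (V ⊕ V ⊕ Unit) :=
  SimpleGraph.fromRel fun a b =>
    match a, b with
    | .inl x, .inl y => G.Adj x y
    | .inr (.inl x), .inl y => G.Adj x y
    | .inr (.inl _), .inr (.inr _) => True
    | _, _ => False

/-- The Grötzsch graph: the Mycielskian of the cycle on five vertices. -/
def grotzschGraph : SimpleGraph (Fin 5 ⊕ Fin 5 ⊕ Unit) :=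
  mycielskian (SimpleGraph.cycleGraph 5)

/-- `x ↪ y`: there is an arrow `x → y`, and `z → x` implies `z → y`. -/
def IsInto {V : Type*} (r : V → V → Prop) (x y : V) : Prop :=
  r x y ∧ ∀ z, r z x → r z y

/-- `x ↠ y`: there is an arrow `x → y`, and `y → z` implies `x → z`. -/
def IsOnto {V : Type*} (r : V → V → Prop) (x y : V) : Prop :=
  r x y ∧ ∀ z, r y z → r x z

/-- A directed graph with arrows `r` (all the loops being arrows) forms a two-acyclic factorization
system. -/
structure IsTwoAcyclicFactorizationSystem {V : Type*} (r : V → V → Prop) : Prop where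
  order_onto : ∀ x y, x ≠ y → ¬ (IsOnto r x y ∧ IsOnto r y x)
  order_into : ∀ x y, x ≠ y → ¬ (IsInto r x y ∧ IsInto r y x)
  brick : ∀ x y, x ≠ y → ¬ (IsOnto r x y ∧ IsInto r y x)
  multiplication : ∀ x z, r x z → ∃ y, IsOnto r x y ∧ IsInto r y z

/-- A simple graph admits a two-acyclic factorization system if its edges can be oriented, each in
one direction, such that the directed graph obtained after adding a loop at every vertex forms a
two-acyclic factorization system. -/
def AdmitsTwoAcyclicFactorizationSystem {V : Type*} (G : SimpleGraph V) : Prop :=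
  ∃ o : V → V → Prop, (∀ x y, o x y → ¬ o y x) ∧ (∀ x y, G.Adj x y ↔ o x y ∨ o y x) ∧
    IsTwoAcyclicFactorizationSystem fun x y => x = y ∨ o x y

end Digraphs

end CanonicalJoin

/-! In a triangle-free graph, a factorization `x ↠ y ↪ z` of an arrow must have `y = x` or `y = z`.
If `x ↪ z`, another arrow into `x` would close a triangle, so `x` is a source; if `x ↠ z`, dually
`z` is a sink. Hence sources, sinks and the remaining vertices form three colour classes.
Conversely, orienting the edges from smaller to greater colours makes every arrow leave a source or
enter a sink.

Lattices enter through `κ`: on the join-irreducibles of a finite semidistributive lattice, the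
relation `¬ i ≤ κ j` is a two-acyclic factorization system
(`isTwoAcyclicFactorizationSystem_of_isKappa`), and its underlying graph is the complement of the
canonical join graph. So a triangle-free complement of a canonical join graph is 3-colourable. The
Grötzsch graph is triangle-free but not 3-colourable, so its complement is no canonical join graph.

In the other direction, the maximal orthogonal pairs of a two-acyclic factorization system form a
semidistributive lattice whose join-irreducibles correspond to the vertices
(`isKappa_ofObject_ofAttribute`), and acyclicity makes it extremal. The given digraph is such a
system; without `t` its underlying graph is the Grötzsch graph. -/

namespace CanonicalJoin

/-! ### Triangle-free graphs: factorization systems and 3-colourings -/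

section Colorings

variable {V : Type*} {G : SimpleGraph V} {r : V → V → Prop}

theorem not_adj_of_adj_of_adj (hG : G.CliqueFree 3) {x y z : V} (hxy : G.Adj x y)
    (hyz : G.Adj y z) : ¬ G.Adj x z := by
  classical
  intro hxz
  exact hG {x, y, z} (SimpleGraph.is3Clique_triple_iff.2 ⟨hxy, hxz, hyz⟩)

/-- A triangle-free graph whose edges come from a two-acyclic factorization system, possibly with
arrows in both directions, can be coloured with three colours: sources, sinks, and the rest. -/
theorem IsTwoAcyclicFactorizationSystem.colorable_three
    (h : IsTwoAcyclicFactorizationSystem r) (hG : G.CliqueFree 3)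
    (hadj : ∀ x y, G.Adj x y ↔ x ≠ y ∧ (r x y ∨ r y x)) : G.Colorable 3 := by
  classical
  have factor : ∀ x z, x ≠ z → r x z → IsInto r x z ∨ IsOnto r x z := by
    intro x z hxz hrxz
    obtain ⟨y, hxy, hyz⟩ := h.multiplication x z hrxz
    by_cases h1 : x = y
    · exact .inl (h1 ▸ hyz)
    by_cases h2 : y = z
    · exact .inr (h2 ▸ hxy)
    exact absurd ((hadj x z).2 ⟨hxz, .inl hrxz⟩) (not_adj_of_adj_of_adj hG
      ((hadj x y).2 ⟨h1, .inl hxy.1⟩) ((hadj y z).2 ⟨h2, .inl hyz.1⟩))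
  -- Each of two opposite arrows is `↪` or `↠`; the acyclicity axioms exclude all four combinations.
  have asymm : ∀ x y, x ≠ y → r x y → ¬ r y x := by
    intro x y hxy h1 h2
    rcases factor x y hxy h1 with a | a <;> rcases factor y x hxy.symm h2 with b | b
    · exact h.order_into x y hxy ⟨a, b⟩
    · exact h.brick y x hxy.symm ⟨b, a⟩
    · exact h.brick x y hxy ⟨a, b⟩
    · exact h.order_onto x y hxy ⟨a, b⟩
  have source_or_sink : ∀ x z, x ≠ z → r x z →
      (∀ w, r w x → w = x) ∨ (∀ w, r z w → w = z) := by
    intro x z hxz hrxz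
    refine (factor x z hxz hrxz).imp (fun hi w hw => ?_) (fun ho w hw => ?_)
    · by_contra hwx
      by_cases hwz : w = z
      · exact asymm x z hxz hrxz (hwz ▸ hw)
      exact absurd ((hadj w z).2 ⟨hwz, .inl (hi.2 w hw)⟩) (not_adj_of_adj_of_adj hG
        ((hadj w x).2 ⟨hwx, .inl hw⟩) ((hadj x z).2 ⟨hxz, .inl hrxz⟩))
    · by_contra hwz
      by_cases hwx : w = x
      · exact asymm x z hxz hrxz (hwx ▸ hw)
      exact absurd ((hadj x w).2 ⟨Ne.symm hwx, .inl (ho.2 w hw)⟩) (not_adj_of_adj_of_adj hG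
        ((hadj x z).2 ⟨hxz, .inl hrxz⟩) ((hadj z w).2 ⟨Ne.symm hwz, .inl hw⟩))
  let c : V → Fin 3 := fun x =>
    if ∀ w, r w x → w = x then 0 else if ∀ w, r x w → w = x then 1 else 2
  have hc : ∀ x y, x ≠ y → r x y → c x ≠ c y := by
    intro x y hxy hrxy
    have hy : ¬ ∀ w, r w y → w = y := fun hy => hxy (hy x hrxy)
    have hx : ¬ ∀ w, r x w → w = x := fun hx => hxy (hx y hrxy).symm
    rcases source_or_sink x y hxy hrxy with h1 | h1
    · simp only [c, if_pos h1, if_neg hy]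
      split_ifs <;> decide
    · simp only [c, if_neg hx, if_neg hy, if_pos h1]
      split_ifs <;> decide
  refine ⟨SimpleGraph.Coloring.mk c fun {x y} hxy => ?_⟩
  obtain ⟨hne, h1 | h1⟩ := (hadj x y).1 hxy
  · exact hc x y hne h1
  · exact (hc y x hne.symm h1).symm

theorem AdmitsTwoAcyclicFactorizationSystem.colorable_three (hG : G.CliqueFree 3)
    (h : AdmitsTwoAcyclicFactorizationSystem G) : G.Colorable 3 := by
  obtain ⟨o, -, hadj, ho⟩ := h
  refine ho.colorable_three hG fun x y => ?_
  constructor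
  · exact fun hxy => ⟨hxy.ne, ((hadj x y).1 hxy).imp .inr .inr⟩
  · rintro ⟨hne, (h1 | h1) | (h1 | h1)⟩
    · exact absurd h1 hne
    · exact (hadj x y).2 (.inl h1)
    · exact absurd h1.symm hne
    · exact (hadj x y).2 (.inr h1)

/-- If one colour class of a three-colouring consists of sources and another of sinks, then the
edges form a two-acyclic factorization system. -/
theorem admitsTwoAcyclicFactorizationSystem_of_colorable_three (h : G.Colorable 3) :
    AdmitsTwoAcyclicFactorizationSystem G := by
  obtain ⟨c⟩ := h
  have hlt : ∀ x y, G.Adj x y → c x < c y ∨ c y < c x := fun x y hxy =>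
    lt_or_gt_of_ne (c.valid hxy)
  have into_of : ∀ x y, G.Adj x y → c x < c y → c x = 0 →
      IsInto (fun x y => x = y ∨ G.Adj x y ∧ c x < c y) x y := by
    refine fun x y hxy hc h0 => ⟨.inr ⟨hxy, hc⟩, ?_⟩
    rintro z (rfl | ⟨-, hz⟩)
    · exact .inr ⟨hxy, hc⟩
    · omega
  have onto_of : ∀ x y, G.Adj x y → c x < c y → c y = 2 →
      IsOnto (fun x y => x = y ∨ G.Adj x y ∧ c x < c y) x y := by
    refine fun x y hxy hc h2 => ⟨.inr ⟨hxy, hc⟩, ?_⟩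
    rintro z (rfl | ⟨-, hz⟩)
    · exact .inr ⟨hxy, hc⟩
    · omega
  have asymm : ∀ x y, x ≠ y → (x = y ∨ G.Adj x y ∧ c x < c y) →
      ¬ (y = x ∨ G.Adj y x ∧ c y < c x) := by
    rintro x y hne (h1 | h1) (h2 | h2)
    exacts [hne h1, hne h1, hne h2.symm, h1.2.asymm h2.2]
  refine ⟨fun x y => G.Adj x y ∧ c x < c y, fun x y h1 h2 => h1.2.asymm h2.2, fun x y => ?_, ?_⟩
  · exact ⟨fun hxy => (hlt x y hxy).imp (⟨hxy, ·⟩) (⟨hxy.symm, ·⟩),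
      fun hxy => hxy.elim (·.1) (·.1.symm)⟩
  · refine ⟨fun x y hne h => asymm x y hne h.1.1 h.2.1, fun x y hne h => asymm x y hne h.1.1 h.2.1,
      fun x y hne h => asymm x y hne h.1.1 h.2.1, ?_⟩
    rintro x z (rfl | ⟨hxz, hc⟩)
    · exact ⟨x, ⟨.inl rfl, fun _ => id⟩, ⟨.inl rfl, fun _ => id⟩⟩
    · by_cases h0 : c x = 0
      · exact ⟨x, ⟨.inl rfl, fun _ => id⟩, into_of x z hxz hc h0⟩
      · exact ⟨z, onto_of x z hxz hc (by omega), ⟨.inl rfl, fun _ => id⟩⟩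

end Colorings

end CanonicalJoin

namespace CanonicalJoin

/-! ### The map `κ` and the factorization system of a semidistributive lattice -/

section Kappa

variable {M : Type*} [Lattice M]

/-- The vertices of the canonical join complex are the join-irreducible elements, described as the
elements `j` for which some `m` lies above everything strictly below `j` but not above `j`. -/
theorem mem_vertexSet_canonicalJoinComplex_iff {j : M} :
    j ∈ (canonicalJoinComplex M).vertexSet ↔ ∃ m, (∀ y < j, y ≤ m) ∧ ¬ j ≤ m := by
  constructor
  · rintro ⟨-, x, hx⟩
    have hj : j ∈ downLabels x := hx ▸ by simp
    obtain ⟨y, hy, ⟨hjx, hjy⟩, hmin⟩ := hj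
    exact ⟨y, fun z hz => by_contra fun hzy => hz.not_ge (hmin ⟨hz.le.trans hjx, hzy⟩), hjy⟩
  · rintro ⟨m, hm, hjm⟩
    have hj : j ∈ downLabels j := by
      refine ⟨j ⊓ m, ⟨lt_of_le_of_ne inf_le_left fun h => hjm (inf_eq_left.1 h), ?_⟩,
        ⟨le_rfl, fun h => hjm (h.trans inf_le_right)⟩, ?_⟩
      · exact fun d hd hdj => hd.not_ge (le_inf hdj.le (hm d hdj))
      · rintro z ⟨hz, hzm⟩
        by_contra hjz
        exact hzm (le_inf hz (hm z (lt_of_le_not_ge hz hjz)))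
    refine ⟨by simp, j, ?_⟩
    have := eq_downLabels_sup' (x := j) {j} (by simp) (by simpa using hj)
    simpa using this

/-- `m` is the greatest element that lies above all elements strictly below `j`, but not above
`j`. -/
def IsKappa (j m : M) : Prop :=
  IsGreatest {m | (∀ y < j, y ≤ m) ∧ ¬ j ≤ m} m

variable {i j m n : M}

theorem IsKappa.mem_vertexSet (h : IsKappa j m) : j ∈ (canonicalJoinComplex M).vertexSet :=
  mem_vertexSet_canonicalJoinComplex_iff.2 ⟨m, h.1⟩

/-- All candidates `m` have the same meet with `j`, so by meet-semidistributivity the join of two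
candidates is a candidate; a maximal one is therefore the greatest. -/
theorem IsSemidistributive.exists_isKappa [Finite M] (hM : IsSemidistributive M)
    (hj : j ∈ (canonicalJoinComplex M).vertexSet) : ∃ m, IsKappa j m := by
  obtain ⟨m₀, hm₀⟩ := mem_vertexSet_canonicalJoinComplex_iff.1 hj
  obtain ⟨m, -, hm⟩ := (Set.toFinite {m : M | (∀ y < j, y ≤ m) ∧ ¬ j ≤ m}).exists_le_maximal hm₀
  have inf_eq : ∀ n : M, ((∀ y < j, y ≤ n) ∧ ¬ j ≤ n) → j ⊓ n = j ⊓ m := by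
    intro n hn
    have aux : ∀ n n' : M, ((∀ y < j, y ≤ n) ∧ ¬ j ≤ n) → ((∀ y < j, y ≤ n') ∧ ¬ j ≤ n') →
        j ⊓ n ≤ j ⊓ n' := fun n n' h h' => le_inf inf_le_left (h'.1 _
          (lt_of_le_of_ne inf_le_left fun e => h.2 (inf_eq_left.1 e)))
    exact le_antisymm (aux n m hn hm.1) (aux m n hm.1 hn)
  refine ⟨m, hm.1, fun n hn => ?_⟩
  have hs : j ⊓ (m ⊔ n) = j ⊓ m := hM.meet j m n (inf_eq n hn).symm
  have := hm.2 (y := m ⊔ n) ⟨fun y hy => (hm.1.1 y hy).trans le_sup_left, fun h =>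
    hm.1.2 (inf_eq_left.1 (hs.symm.trans (inf_eq_left.2 h)))⟩ le_sup_left
  exact le_sup_right.trans this

theorem IsKappa.le_of_not_le (h : IsKappa j m) {z : M} (hmz : m ≤ z) (hzm : ¬ z ≤ m) : j ≤ z := by
  by_contra hjz
  exact hzm (h.2 ⟨fun y hy => (h.1.1 y hy).trans hmz, hjz⟩)

/-- `j` is the label of the cover of `m` by `j ⊔ m`. -/
theorem IsKappa.le_of_le_sup (hM : IsSemidistributive M) (h : IsKappa j m) {z : M}
    (hz : z ≤ j ⊔ m) (hzm : ¬ z ≤ m) : j ≤ z := by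
  have hj : j ≤ m ⊔ z := h.le_of_not_le le_sup_left fun hh => hzm (le_sup_right.trans hh)
  have heq : m ⊔ z = m ⊔ j := le_antisymm (sup_le le_sup_left (hz.trans (sup_comm j m).le))
    (sup_le le_sup_left hj)
  have hs := hM.join m z j heq
  by_contra hjz
  have hlt : z ⊓ j ≤ m := h.1.1 _ (lt_of_le_of_ne inf_le_right fun e => hjz (inf_eq_right.1 e))
  rw [sup_eq_left.2 hlt] at hs
  exact hzm (sup_eq_left.1 hs.symm)

theorem IsKappa.eq_of_eq (hM : IsSemidistributive M) (hi : IsKappa i m) (hj : IsKappa j m) :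
    i = j := by
  have aux : ∀ i j, IsKappa i m → IsKappa j m → i ≤ j := fun i j hi hj =>
    hi.le_of_le_sup hM ((hj.le_of_not_le (z := i ⊔ m) le_sup_right
      fun h => hi.1.2 (le_sup_left.trans h))) hj.1.2
  exact le_antisymm (aux i j hi hj) (aux j i hj hi)

/-- Two join-irreducible elements occur in a common downward label set if and only if each of them
lies below the `κ` of the other. -/
theorem IsKappa.exists_downLabels_iff (hM : IsSemidistributive M) (hij : i ≠ j)
    (hi : IsKappa i m) (hj : IsKappa j n) :
    (∃ x, i ∈ downLabels x ∧ j ∈ downLabels x) ↔ i ≤ n ∧ j ≤ m := by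
  constructor
  · have aux : ∀ i j m n : M, i ≠ j → IsKappa i m → IsKappa j n →
        ∀ x, i ∈ downLabels x → j ∈ downLabels x → i ≤ n := by
      rintro i j m n hij hi hj x ⟨y, hy, hiy⟩ ⟨z, hz, hjz⟩
      have hyz : y ≠ z := fun h => hij (hiy.unique (h ▸ hjz))
      -- Distinct lower covers `y`, `z` of `x` are incomparable, so `z` lies in the set whose
      -- minimum is `i`.
      have hiz : i ≤ z := by
        by_contra hiz
        exact hiz (hiy.2 ⟨hz.le, fun h => hz.2 (lt_of_le_of_ne h hyz.symm) hy.lt⟩)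
      refine hiz.trans (hj.2 ⟨fun w hw => ?_, hjz.1.2⟩)
      by_contra hwz
      exact hw.not_ge (hjz.2 ⟨hw.le.trans hjz.1.1, hwz⟩)
    rintro ⟨x, hix, hjx⟩
    exact ⟨aux i j m n hij hi hj x hix hjx, aux j i n m hij.symm hj hi x hjx hix⟩
  -- The common element is `i ⊔ j`; its lower cover with label `j` is its meet with `κ j`.
  · have aux : ∀ i j n : M, IsKappa j n → i ≤ n → j ∈ downLabels (i ⊔ j) := by
      intro i j n hj hin
      have key : ∀ z, z ≤ i ⊔ j → ¬ z ≤ (i ⊔ j) ⊓ n → j ≤ z := fun z hz hzn =>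
        hj.le_of_le_sup hM (hz.trans (sup_le (hin.trans le_sup_right) le_sup_left))
          fun h => hzn (le_inf hz h)
      have hjn : ¬ j ≤ (i ⊔ j) ⊓ n := fun h => hj.1.2 (h.trans inf_le_right)
      refine ⟨(i ⊔ j) ⊓ n, ⟨lt_of_le_not_ge inf_le_left fun h => hjn (le_sup_right.trans h), ?_⟩,
        ⟨le_sup_right, hjn⟩, fun z hz => key z hz.1 hz.2⟩
      exact fun d hd hdx => hdx.not_ge (sup_le ((le_inf le_sup_left hin).trans hd.le)
        (key d hdx.le hd.not_ge))
    rintro ⟨hin, hjm⟩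
    exact ⟨i ⊔ j, sup_comm j i ▸ aux j i m hi hjm, aux i j n hj hin⟩

theorem pair_mem_faces_canonicalJoinComplex [DecidableEq M] {x : M} (hi : i ∈ downLabels x)
    (hj : j ∈ downLabels x) : {i, j} ∈ (canonicalJoinComplex M).faces :=
  ⟨by simp, _, eq_downLabels_sup' (x := x) {i, j} (by simp) (by
    intro a ha
    rcases (by simpa using ha : a = i ∨ a = j) with rfl | rfl <;> assumption)⟩

theorem oneSkeleton_canonicalJoinComplex_adj_iff (hM : IsSemidistributive M)
    (a b : (canonicalJoinComplex M).vertexSet) (ha : IsKappa (a : M) m) (hb : IsKappa (b : M) n) :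
    (canonicalJoinComplex M).oneSkeleton.Adj a b ↔ a ≠ b ∧ (a : M) ≤ n ∧ (b : M) ≤ m := by
  classical
  refine and_congr_right fun hab => ?_
  rw [← ha.exists_downLabels_iff hM (fun h => hab (Subtype.ext h)) hb]
  constructor
  · rintro ⟨s, ⟨-, x, hx⟩, has, hbs⟩
    exact ⟨x, hx ▸ has, hx ▸ hbs⟩
  · rintro ⟨x, hax, hbx⟩
    exact ⟨_, pair_mem_faces_canonicalJoinComplex hax hbx, by simp, by simp⟩

theorem exists_vertex_le_not_le [Finite M] {x y : M} (h : ¬ x ≤ y) :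
    ∃ j ∈ (canonicalJoinComplex M).vertexSet, j ≤ x ∧ ¬ j ≤ y ∧ ∀ z < j, z ≤ y := by
  obtain ⟨j, -, hj⟩ := (Set.toFinite {j : M | j ≤ x ∧ ¬ j ≤ y}).exists_le_minimal
    (show x ∈ {j : M | j ≤ x ∧ ¬ j ≤ y} from ⟨le_rfl, h⟩)
  have hlt : ∀ z < j, z ≤ y := fun z hz => by_contra fun hzy =>
    hz.not_ge (hj.2 ⟨hz.le.trans hj.1.1, hzy⟩ hz.le)
  exact ⟨j, mem_vertexSet_canonicalJoinComplex_iff.2 ⟨y, hlt, hj.1.2⟩, hj.1.1, hj.1.2, hlt⟩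

/-- Here `x ↠ y` forces `y ≤ x`, and `x ↪ y` forces `κ y ≤ κ x`. The order axioms become
antisymmetry together with injectivity of `κ`. For `brick`, `y < x` gives `y ≤ κ x ≤ κ y`, which is
absurd. To factor `x → z`, take a minimal element below `x` but not below `κ z`. -/
theorem isTwoAcyclicFactorizationSystem_of_isKappa [Finite M] (hM : IsSemidistributive M)
    (κ : (canonicalJoinComplex M).vertexSet → M) (hκ : ∀ j : (canonicalJoinComplex M).vertexSet, IsKappa (j : M) (κ j)) :
    IsTwoAcyclicFactorizationSystem
      fun i j : (canonicalJoinComplex M).vertexSet => ¬ (i : M) ≤ κ j := by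
  have le_of_onto : ∀ x y, IsOnto (fun i j : (canonicalJoinComplex M).vertexSet =>
      ¬ (i : M) ≤ κ j) x y → (y : M) ≤ x := by
    intro x y h
    by_contra hyx
    obtain ⟨k, hk, hky, hkx, hlt⟩ := exists_vertex_le_not_le hyx
    exact h.2 ⟨k, hk⟩ (fun hle => (hκ ⟨k, hk⟩).1.2 (hky.trans hle)) ((hκ ⟨k, hk⟩).2 ⟨hlt, hkx⟩)
  have le_of_into : ∀ x y, IsInto (fun i j : (canonicalJoinComplex M).vertexSet =>
      ¬ (i : M) ≤ κ j) x y → κ y ≤ κ x := by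
    intro x y h
    by_contra hyx
    obtain ⟨k, hk, hky, hkx, -⟩ := exists_vertex_le_not_le hyx
    exact h.2 ⟨k, hk⟩ hkx hky
  refine ⟨fun x y hne h => hne (Subtype.ext (le_antisymm (le_of_onto y x h.2) (le_of_onto x y h.1))),
    fun x y hne h => hne (Subtype.ext ?_), fun x y hne h => ?_, fun x z hxz => ?_⟩
  · have heq := le_antisymm (le_of_into x y h.1) (le_of_into y x h.2)
    exact (hκ x).eq_of_eq hM (heq ▸ hκ y)
  · have hlt : (y : M) < x := lt_of_le_of_ne (le_of_onto x y h.1) fun e => hne (Subtype.ext e.symm)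
    exact (hκ y).1.2 (((hκ x).1.1 _ hlt).trans (le_of_into y x h.2))
  · obtain ⟨k, hk, hkx, hkz, hlt⟩ := exists_vertex_le_not_le hxz
    have hle : κ z ≤ κ ⟨k, hk⟩ := (hκ ⟨k, hk⟩).2 ⟨hlt, hkz⟩
    exact ⟨⟨k, hk⟩, ⟨fun h => (hκ ⟨k, hk⟩).1.2 (hkx.trans h), fun w hw h => hw (hkx.trans h)⟩,
      ⟨hkz, fun w hw h => hw (h.trans hle)⟩⟩

/-- If the complement of a canonical join graph is triangle-free, it can be coloured with three
colours. -/
theorem IsCanonicalJoinGraph.compl_colorable_three {V : Type*} {G : SimpleGraph V}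
    (hG : G.CliqueFree 3) (h : IsCanonicalJoinGraph Gᶜ) : G.Colorable 3 := by
  obtain ⟨M, _, _, hM, ⟨e⟩⟩ := h
  choose κ hκ using fun j : (canonicalJoinComplex M).vertexSet => hM.exists_isKappa j.2
  have hadj : ∀ a b, ((canonicalJoinComplex M).oneSkeleton)ᶜ.Adj a b ↔
      a ≠ b ∧ (¬ (a : M) ≤ κ b ∨ ¬ (b : M) ≤ κ a) := by
    intro a b
    rw [SimpleGraph.compl_adj, oneSkeleton_canonicalJoinComplex_adj_iff hM a b (hκ a) (hκ b)]
    tauto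
  have e' : G ≃g ((canonicalJoinComplex M).oneSkeleton)ᶜ :=
    ⟨e.toEquiv, fun {a b} => by
      have := e.map_rel_iff (a := a) (b := b)
      simp only [SimpleGraph.compl_adj] at this ⊢
      rw [show (canonicalJoinComplex M).oneSkeleton.Adj (e.toEquiv a) (e.toEquiv b) ↔ _ from this]
      have hne := @SimpleGraph.Adj.ne _ G a b
      rw [ne_eq, e.toEquiv.injective.eq_iff]
      tauto⟩
  have hcf : ((canonicalJoinComplex M).oneSkeleton)ᶜ.CliqueFree 3 :=
    hG.comap e'.symm.isContained
  have hcol := (isTwoAcyclicFactorizationSystem_of_isKappa hM κ hκ).colorable_three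
    hcf hadj
  exact hcol.of_hom e'.toHom

end Kappa

end CanonicalJoin

/-! ### Skeletons, isomorphisms and induced subcomplexes -/

namespace PreAbstractSimplicialComplex

theorem oneSkeleton_adj_iff {α : Type*} [DecidableEq α] (K : PreAbstractSimplicialComplex α)
    (a b : K.vertexSet) : K.oneSkeleton.Adj a b ↔ a ≠ b ∧ {(a : α), (b : α)} ∈ K.faces := by
  refine and_congr_right fun _ => ⟨?_, fun h => ⟨_, h, by simp, by simp⟩⟩
  rintro ⟨s, hs, ha, hb⟩
  refine (K.isRelLowerSet_faces hs).2 ?_ (by simp)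
  intro x hx
  rcases (by simpa using hx : x = a ∨ x = b) with rfl | rfl <;> assumption

theorem Isomorphic.oneSkeleton {α β : Type*} {K : PreAbstractSimplicialComplex α}
    {K' : PreAbstractSimplicialComplex β} (h : K.Isomorphic K') :
    Nonempty (K.oneSkeleton ≃g K'.oneSkeleton) := by
  classical
  obtain ⟨e, he⟩ := h
  refine ⟨⟨e, fun {a b} => ?_⟩⟩
  rw [oneSkeleton_adj_iff, oneSkeleton_adj_iff, ne_eq, e.injective.eq_iff]
  refine and_congr_right fun _ => ?_
  simpa using (he {a, b}).symm

theorem mem_vertexSet_induce {α : Type*} (K : PreAbstractSimplicialComplex α) (X : Set α) (a : α) :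
    a ∈ (K.induce X).vertexSet ↔ a ∈ K.vertexSet ∧ a ∈ X := by
  simp [vertexSet, induce]

theorem oneSkeleton_induce_adj_iff {α : Type*} (K : PreAbstractSimplicialComplex α) (X : Set α)
    (a b : (K.induce X).vertexSet) : (K.induce X).oneSkeleton.Adj a b ↔
      K.oneSkeleton.Adj ⟨a, ((K.mem_vertexSet_induce X a).1 a.2).1⟩
        ⟨b, ((K.mem_vertexSet_induce X b).1 b.2).1⟩ := by
  classical
  have ha := ((K.mem_vertexSet_induce X a).1 a.2).2
  have hb := ((K.mem_vertexSet_induce X b).1 b.2).2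
  rw [oneSkeleton_adj_iff, oneSkeleton_adj_iff]
  refine and_congr (by simp [Subtype.ext_iff]) ?_
  simp [induce, Set.insert_subset_iff, ha, hb]

end PreAbstractSimplicialComplex

namespace CanonicalJoin

theorem IsCanonicalJoinComplex.isCanonicalJoinGraph {α : Type*}
    {K : PreAbstractSimplicialComplex α} (h : IsCanonicalJoinComplex.{u} K) :
    IsCanonicalJoinGraph.{u} K.oneSkeleton := by
  obtain ⟨M, i, hf, hM, hK⟩ := h
  exact ⟨M, i, hf, hM, hK.oneSkeleton⟩

end CanonicalJoin

namespace CanonicalJoin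

/-! ### Criteria for semidistributivity and extremality -/

section FiniteLattices

variable {M N : Type*} [Lattice M] [Lattice N]

/-- If the equality failed, a minimal `j` below `x ⊓ (y ⊔ z)` but not below `x ⊓ y` would have `y`
and `z`, hence `y ⊔ z`, below `κ j`, although `j ≤ y ⊔ z`. -/
theorem inf_sup_eq_of_exists_isKappa [Finite M]
    (hκ : ∀ j ∈ (canonicalJoinComplex M).vertexSet, ∃ m, IsKappa j m) {x y z : M}
    (h : x ⊓ y = x ⊓ z) : x ⊓ (y ⊔ z) = x ⊓ y := by
  refine le_antisymm ?_ (inf_le_inf_left x le_sup_left)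
  by_contra hle
  obtain ⟨j, hj, hj1, hj2, hlt⟩ := exists_vertex_le_not_le hle
  obtain ⟨m, hm⟩ := hκ j hj
  have hjx : j ≤ x := hj1.trans inf_le_left
  have hy : y ≤ m := hm.2 ⟨fun w hw => (hlt w hw).trans inf_le_right, fun hjy => hj2 (le_inf hjx hjy)⟩
  have hz : z ≤ m := hm.2 ⟨fun w hw => ((hlt w hw).trans h.le).trans inf_le_right,
    fun hjz => hj2 (h ▸ le_inf hjx hjz)⟩
  exact hm.1.2 ((hj1.trans inf_le_right).trans (sup_le hy hz))

theorem isSemidistributive_of_exists_isKappa [Finite M] [Finite N] (e : Mᵒᵈ ≃o N)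
    (hM : ∀ j ∈ (canonicalJoinComplex M).vertexSet, ∃ m, IsKappa j m)
    (hN : ∀ j ∈ (canonicalJoinComplex N).vertexSet, ∃ m, IsKappa j m) : IsSemidistributive M := by
  refine ⟨fun x y z h => ?_, fun x y z h => inf_sup_eq_of_exists_isKappa hM h⟩
  let f : M → N := fun a => e (OrderDual.toDual a)
  have hf : Function.Injective f := e.injective
  have hsup : ∀ a b, f (a ⊔ b) = f a ⊓ f b := fun a b => e.map_inf _ _
  have hinf : ∀ a b, f (a ⊓ b) = f a ⊔ f b := fun a b => e.map_sup _ _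
  apply hf
  rw [hsup, hinf, hsup]
  exact inf_sup_eq_of_exists_isKappa hN (by rw [← hsup, ← hsup, h])

theorem joinIrreducibles_eq_vertexSet [Finite M] :
    joinIrreducibles M = (canonicalJoinComplex M).vertexSet := by
  ext j
  rw [mem_vertexSet_canonicalJoinComplex_iff]
  constructor
  · rintro ⟨x, hx, huniq⟩
    refine ⟨x, fun y hy => ?_, hx.lt.not_ge⟩
    obtain ⟨c, hc, hcj⟩ := exists_le_covBy_of_lt hy
    exact huniq c hcj ▸ hc
  · rintro ⟨m, hm, hjm⟩
    have hlt : j ⊓ m < j := lt_of_le_of_ne inf_le_left fun h => hjm (inf_eq_left.1 h)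
    have hle : ∀ y < j, y ≤ j ⊓ m := fun y hy => le_inf hy.le (hm y hy)
    refine ⟨j ⊓ m, ⟨hlt, fun d hd hdj => hd.not_ge (hle d hdj)⟩, fun y hy => ?_⟩
    exact (hy.eq_or_eq (hle y hy.lt) hlt.le).resolve_right hlt.ne |>.symm

/-- The number of join-irreducibles below `x` is strictly increasing in `x`. -/
theorem krullDim_le_ncard_joinIrreducibles [Finite M] :
    Order.krullDim M ≤ ((joinIrreducibles M).ncard : WithBot ℕ∞) := by
  let f : M → Fin ((joinIrreducibles M).ncard + 1) := fun x =>
    ⟨{j ∈ joinIrreducibles M | j ≤ x}.ncard, Nat.lt_succ_of_le (Set.ncard_le_ncard fun j hj => hj.1)⟩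
  have hf : StrictMono f := by
    intro x y hxy
    obtain ⟨j, hj, hjy, hjx, -⟩ := exists_vertex_le_not_le hxy.not_ge
    rw [← joinIrreducibles_eq_vertexSet] at hj
    exact Set.ncard_lt_ncard ⟨fun k hk => ⟨hk.1, hk.2.trans hxy.le⟩, fun h => hjx (h ⟨hj, hjy⟩).2⟩
  refine iSup_le fun p => ?_
  have := (p.map f hf).length_lt_card
  rw [Fintype.card_fin] at this
  exact_mod_cast Nat.lt_succ_iff.1 this

theorem ncard_meetIrreducibles (e : Mᵒᵈ ≃o N) :
    (meetIrreducibles M).ncard = (joinIrreducibles N).ncard := by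
  have hcov : ∀ a b : M, e (OrderDual.toDual a) ⋖ e (OrderDual.toDual b) ↔ b ⋖ a := fun a b =>
    (apply_covBy_apply_iff e).trans toDual_covBy_toDual_iff
  let e' : M ≃ N := OrderDual.toDual.trans e.toEquiv
  rw [← Set.ncard_image_of_injective _ e'.injective]
  congr 1
  ext j
  obtain ⟨a, rfl⟩ := e'.surjective j
  rw [e'.injective.mem_set_image]
  exact (e'.bijective.existsUnique_iff).trans (existsUnique_congr fun b => hcov b a) |>.symm

end FiniteLattices

/-! ### The lattice of maximal orthogonal pairs of a factorization system -/

section ConceptLattices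

open Concept

variable {V : Type*} {r R : V → V → Prop}

theorem IsTwoAcyclicFactorizationSystem.swap (h : IsTwoAcyclicFactorizationSystem r) :
    IsTwoAcyclicFactorizationSystem (Function.swap r) where
  order_onto x y hne hxy := h.order_into x y hne ⟨hxy.2, hxy.1⟩
  order_into x y hne hxy := h.order_onto x y hne ⟨hxy.2, hxy.1⟩
  brick x y hne hxy := h.brick x y hne ⟨hxy.2, hxy.1⟩
  multiplication x z hxz := by
    obtain ⟨y, h1, h2⟩ := h.multiplication z x hxz
    exact ⟨y, h2, h1⟩

theorem mem_extent_of_isOnto (hR : ∀ x y, R x y ↔ ¬ r x y) {c : Concept V V R} {x y : V}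
    (hx : x ∈ c.extent) (hxy : IsOnto r x y) : y ∈ c.extent := by
  rw [← c.lowerPolar_intent]
  exact fun w hw => (hR y w).2 fun hyw => (hR x w).1 (rel_extent_intent hx hw) (hxy.2 w hyw)

theorem isOnto_iff_ofObject_le (hr : ∀ x, r x x) (hR : ∀ x y, R x y ↔ ¬ r x y) {x y : V} :
    IsOnto r x y ↔ ofObject R y ≤ ofObject R x := by
  have hiff : ofObject R y ≤ ofObject R x ↔ ∀ z, r y z → r x z := by
    rw [ofObjects_le_iff, Set.singleton_subset_iff]
    refine forall_congr' fun z => ?_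
    change z ∈ (ofObject R x).intent → R y z ↔ _
    rw [intent_ofObjects, mem_upperPolar_singleton, hR, hR, not_imp_not]
  rw [hiff, IsOnto]
  exact ⟨And.right, fun h => ⟨h y (hr y), h⟩⟩

variable (hr : ∀ x, r x x) (h : IsTwoAcyclicFactorizationSystem r) (hR : ∀ x y, R x y ↔ ¬ r x y)

include hr h hR

/-- In the lattice of maximal orthogonal pairs of a two-acyclic factorization system, the greatest
element without arrows to `v` is the `κ` of the least element containing `v`. -/
theorem isKappa_ofObject_ofAttribute (v : V) : IsKappa (ofObject R v) (ofAttribute R v) := by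
  refine ⟨⟨fun y hy => ?_, fun hle => (hR v v).1 (ofObject_le_ofAttribute_iff.1 hle) (hr v)⟩, ?_⟩
  · have hvy : v ∉ y.extent := fun hv =>
      hy.not_ge (ofObjects_le_iff.2 (Set.singleton_subset_iff.2 hv))
    intro u hu
    rw [extent_ofAttributes, mem_lowerPolar_singleton, hR]
    intro huv
    -- Extents are closed under `↠`, so `a` lies in `y`, which is below the concept of `v`. Thus `v
    -- ↠ a ↪ v`, against `brick`.
    obtain ⟨a, hua, hav⟩ := h.multiplication u v huv
    have hay := mem_extent_of_isOnto hR hu hua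
    have hva : IsOnto r v a := (isOnto_iff_ofObject_le hr hR).2
      ((ofObjects_le_iff.2 (Set.singleton_subset_iff.2 hay)).trans hy.le)
    exact h.brick v a (fun e => hvy (e ▸ hay)) ⟨hva, hav⟩
  · rintro y ⟨hlt, hvy⟩
    rw [ofObjects_le_iff, Set.singleton_subset_iff, ← y.lowerPolar_intent,
      mem_lowerPolar_iff] at hvy
    push Not at hvy
    obtain ⟨w, hw, hvw⟩ := hvy
    rw [hR, not_not] at hvw
    -- If `a ≠ v`, the concept of `a` is strictly below that of `v`, so `a` lies in `y`,
    -- contradicting `a → w`. Hence `v ↪ w`, and an arrow from `y` to `v` would give one to `w`.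
    obtain ⟨a, hva, haw⟩ := h.multiplication v w hvw
    have hav : a = v := by
      by_contra hne
      have hle := (isOnto_iff_ofObject_le hr hR).1 hva
      have hay := hlt (ofObject R a) (lt_of_le_not_ge hle fun hle' =>
        h.order_onto a v hne ⟨(isOnto_iff_ofObject_le hr hR).2 hle', hva⟩)
      rw [ofObjects_le_iff, Set.singleton_subset_iff] at hay
      exact (hR a w).1 (rel_extent_intent hay hw) haw.1
    subst hav
    intro u hu
    rw [extent_ofAttributes, mem_lowerPolar_singleton, hR]
    exact fun hua => (hR u w).1 (rel_extent_intent hu hw) (haw.2 u hua)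

/-- Any `v` in the extent of `j` but not in that of `m` generates `j`: otherwise its concept would
be strictly below `j`, hence below `m`. -/
theorem vertexSet_concept :
    (canonicalJoinComplex (Concept V V R)).vertexSet = Set.range (ofObject R) := by
  ext j
  constructor
  · rw [mem_vertexSet_canonicalJoinComplex_iff]
    rintro ⟨m, hm, hjm⟩
    rw [← extent_subset_extent_iff, Set.not_subset] at hjm
    obtain ⟨v, hvj, hvm⟩ := hjm
    have hle : ofObject R v ≤ j := ofObjects_le_iff.2 (Set.singleton_subset_iff.2 hvj)
    refine ⟨v, by_contra fun hne => hvm ?_⟩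
    exact Set.singleton_subset_iff.1 (ofObjects_le_iff.1 (hm _ (lt_of_le_of_ne hle hne)))
  · rintro ⟨v, rfl⟩
    exact (isKappa_ofObject_ofAttribute hr h hR v).mem_vertexSet

theorem ofObject_injective : Function.Injective (ofObject R) := by
  intro x y hxy
  by_contra hne
  exact h.order_onto x y hne ⟨(isOnto_iff_ofObject_le hr hR).2 hxy.ge,
    (isOnto_iff_ofObject_le hr hR).2 hxy.le⟩

theorem exists_isKappa_concept :
    ∀ j ∈ (canonicalJoinComplex (Concept V V R)).vertexSet, ∃ m, IsKappa j m := by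
  rw [vertexSet_concept hr h hR]
  rintro _ ⟨v, rfl⟩
  exact ⟨_, isKappa_ofObject_ofAttribute hr h hR v⟩

variable [Finite V]

theorem isSemidistributive_concept : IsSemidistributive (Concept V V R) :=
  have := Finite.of_injective _ (extent_injective (r := R))
  have := Finite.of_injective _ (extent_injective (r := Function.swap R))
  isSemidistributive_of_exists_isKappa swapEquiv (exists_isKappa_concept hr h hR)
    (exists_isKappa_concept (r := Function.swap r) hr h.swap fun x y => hR y x)

theorem ncard_joinIrreducibles_concept :
    (joinIrreducibles (Concept V V R)).ncard = Nat.card V := by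
  have := Finite.of_injective _ (extent_injective (r := R))
  rw [joinIrreducibles_eq_vertexSet, vertexSet_concept hr h hR,
    Set.ncard_range_of_injective (ofObject_injective hr h hR)]

theorem ncard_meetIrreducibles_concept :
    (meetIrreducibles (Concept V V R)).ncard = Nat.card V :=
  (ncard_meetIrreducibles swapEquiv).trans
    (ncard_joinIrreducibles_concept (r := Function.swap r) hr h.swap fun x y => hR y x)

/-- If the vertices can be ordered such that every arrow goes down, then the initial segments form
a chain of maximal orthogonal pairs, and the lattice is extremal. -/
theorem isExtremal_concept {n : ℕ} (ρ : V ≃ Fin n) (hρ : ∀ x y, r x y → ρ y ≤ ρ x) :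
    IsExtremal (Concept V V R) := by
  have := Finite.of_injective _ (extent_injective (r := R))
  -- The `n + 1` cuts of the ordering give a chain of length `n`. The loops ensure that extent and
  -- intent are complementary.
  let c : Fin (n + 1) → Concept V V R := fun k =>
    { extent := {x | (ρ x).castSucc < k}
      intent := {x | k ≤ (ρ x).castSucc}
      upperPolar_extent := by
        ext w
        refine ⟨fun hw => Set.mem_ofPred.2 <| not_lt.1 fun hlt => (hR w w).1 (hw hlt) (hr w), fun hw v hv => ?_⟩
        exact (hR v w).2 fun hvw => (hw.trans (Fin.castSucc_le_castSucc_iff.2 (hρ v w hvw))).not_gt hv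
      lowerPolar_intent := by
        ext v
        refine ⟨fun hv => Set.mem_ofPred.2 <| not_le.1 fun hle => (hR v v).1 (hv hle) (hr v), fun hv w hw => ?_⟩
        exact (hR v w).2 fun hvw => (hw.trans (Fin.castSucc_le_castSucc_iff.2 (hρ v w hvw))).not_gt hv }
  have hc : StrictMono c := by
    refine Fin.strictMono_iff_lt_succ.2 fun k => extent_ssubset_extent_iff.1 ?_
    refine ⟨fun x hx => lt_trans (show (ρ x).castSucc < k.castSucc from hx) k.castSucc_lt_succ,
      fun hss => ?_⟩
    have hx : ρ.symm k ∈ (c k.succ).extent := by simp [c]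
    simpa [c] using hss hx
  have hn : Nat.card V = n := by simpa using Nat.card_congr ρ
  have hle : (n : WithBot ℕ∞) ≤ Order.krullDim (Concept V V R) :=
    Order.LTSeries.length_le_krullDim (LTSeries.mk n c hc)
  have heq : Order.krullDim (Concept V V R) = (n : WithBot ℕ∞) := by
    refine le_antisymm ?_ hle
    have := krullDim_le_ncard_joinIrreducibles (M := Concept V V R)
    rwa [ncard_joinIrreducibles_concept hr h hR, hn] at this
  constructor
  · rw [ncard_joinIrreducibles_concept hr h hR, hn, heq]
  · rw [ncard_meetIrreducibles_concept hr h hR, hn, heq]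

/-- The canonical join graph of the lattice of maximal orthogonal pairs is the complement of the
underlying graph. -/
theorem oneSkeleton_concept_adj_iff (a b : (canonicalJoinComplex (Concept V V R)).vertexSet)
    {x y : V} (ha : a = ofObject R x) (hb : b = ofObject R y) :
    (canonicalJoinComplex (Concept V V R)).oneSkeleton.Adj a b ↔ x ≠ y ∧ R x y ∧ R y x := by
  rw [oneSkeleton_canonicalJoinComplex_adj_iff (isSemidistributive_concept hr h hR) a b
    (ha ▸ isKappa_ofObject_ofAttribute hr h hR x) (hb ▸ isKappa_ofObject_ofAttribute hr h hR y),
    ha, hb, ofObject_le_ofAttribute_iff, ofObject_le_ofAttribute_iff, ne_eq, Subtype.ext_iff, ha, hb,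
    (ofObject_injective hr h hR).eq_iff]

end ConceptLattices

end CanonicalJoin

namespace CanonicalJoin

/-! ### The digraph on twelve vertices and the Grötzsch graph -/

section Grotzsch

open Concept

/-- The arrows of the directed graph on twelve vertices, with a loop at every vertex. -/
abbrev galoisRel (x y : Fin 12) : Prop := x = y ∨ (x, y) ∈ galoisArrows

/-- The orthogonality relation of the directed graph on twelve vertices. -/
abbrev galoisOrthogonal (x y : Fin 12) : Prop := x ≠ y ∧ ¬ (x, y) ∈ galoisArrows

theorem galoisOrthogonal_iff (x y : Fin 12) : galoisOrthogonal x y ↔ ¬ galoisRel x y :=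
  not_or.symm

-- The `u_i` are sources, and `v₀`, `v₃`, `w` are sinks. The only arrows that neither leave a source
-- nor enter a sink are `v₂ → v₁`, `v₂ → t` and `t → v₁`. The vertex `t` serves to factor the first
-- of them: `v₂ ↠ t ↪ v₁`.
set_option synthInstance.maxSize 1000 in
theorem isTwoAcyclicFactorizationSystem_galoisRel : IsTwoAcyclicFactorizationSystem galoisRel := by
  have asymm : ∀ x y, x ≠ y → galoisRel x y → ¬ galoisRel y x := by decide +kernel
  refine ⟨fun x y hne h => asymm x y hne h.1.1 h.2.1, fun x y hne h => asymm x y hne h.1.1 h.2.1,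
    fun x y hne h => asymm x y hne h.1.1 h.2.1, ?_⟩
  unfold IsOnto IsInto
  decide +kernel

theorem isExtremal_galois : IsExtremal (Concept (Fin 12) (Fin 12) galoisOrthogonal) := by
  let ρ : Fin 12 ≃ Fin 12 :=
    { toFun := ![0, 1, 6, 2, 3, 7, 8, 9, 10, 11, 4, 5]
      invFun := ![0, 1, 3, 4, 10, 11, 2, 5, 6, 7, 8, 9]
      left_inv := by unfold Function.LeftInverse; decide
      right_inv := by unfold Function.RightInverse Function.LeftInverse; decide }
  exact isExtremal_concept (fun x => .inl rfl) isTwoAcyclicFactorizationSystem_galoisRel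
    galoisOrthogonal_iff ρ (by decide +kernel)

/-- The set of the vertices with an arrow to a given vertex, in binary notation. -/
def galoisMask : Fin 12 → ℕ :=
  ![595, 2214, 324, 668, 304, 32, 64, 128, 256, 512, 2016, 2052]

/-- Whether the set with binary notation `n` is the first component of a maximal orthogonal
pair. -/
def isGaloisExtent (n : ℕ) : Bool :=
  (List.finRange 12).all fun v => n.testBit v ||
    (List.finRange 12).any fun w => (galoisMask w).testBit v && (n &&& galoisMask w == 0)

theorem galoisMask_testBit : ∀ v w : Fin 12, (galoisMask w).testBit v = true ↔ galoisRel v w := by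
  decide +kernel

theorem galoisMask_lt : ∀ w, galoisMask w < 2 ^ 12 := by decide

theorem land_galoisMask_eq_zero_iff (n : ℕ) (w : Fin 12) :
    n &&& galoisMask w = 0 ↔ ∀ v : Fin 12, n.testBit v → galoisOrthogonal v w := by
  constructor
  · intro h v hv
    rw [galoisOrthogonal_iff, ← galoisMask_testBit]
    intro hm
    have := congrArg (Nat.testBit · v) h
    simp [Nat.testBit_and, hv, hm] at this
  · intro h
    refine Nat.eq_of_testBit_eq fun i => ?_
    rw [Nat.testBit_and, Nat.zero_testBit, Bool.and_eq_false_iff]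
    by_cases hi : i < 12
    · by_contra! hc
      simp only [ne_eq, Bool.not_eq_false] at hc
      exact (galoisOrthogonal_iff _ _).1 (h ⟨i, hi⟩ hc.1) ((galoisMask_testBit ⟨i, hi⟩ w).1 hc.2)
    · exact .inr (Nat.testBit_lt_two_pow ((galoisMask_lt w).trans_le
        (Nat.pow_le_pow_right (by norm_num) (not_lt.1 hi))))

/-- A set is an extent when its double polar adds nothing: every `v` outside has an arrow to some
`w` that receives no arrow from the set. -/
theorem isGaloisExtent_iff (n : ℕ) : isGaloisExtent n = true ↔
    Order.IsExtent galoisOrthogonal {v : Fin 12 | n.testBit v} := by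
  have hle : Order.IsExtent galoisOrthogonal {v : Fin 12 | n.testBit v} ↔
      lowerPolar galoisOrthogonal (upperPolar galoisOrthogonal {v : Fin 12 | n.testBit v}) ⊆
        {v : Fin 12 | n.testBit v} :=
    Order.isExtent_iff.trans ⟨fun h => h.le, fun h => h.antisymm (subset_lowerPolar_upperPolar _ _)⟩
  rw [hle]
  simp only [isGaloisExtent, List.all_eq_true, List.mem_finRange, true_imp_iff, Bool.or_eq_true,
    List.any_eq_true, true_and, Bool.and_eq_true, beq_iff_eq, galoisMask_testBit,
    land_galoisMask_eq_zero_iff]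
  refine forall_congr' fun v => ?_
  change _ ↔ ((∀ w, (∀ u : Fin 12, n.testBit u → galoisOrthogonal u w) → galoisOrthogonal v w) →
    n.testBit v = true)
  rw [or_iff_not_imp_right]
  refine imp_congr_left ?_
  simp only [galoisOrthogonal_iff v, not_exists, not_and, imp_not_comm]

theorem card_filter_isGaloisExtent :
    ((Finset.range (2 ^ 12)).filter fun n => isGaloisExtent n = true).card = 168 := by
  decide +kernel

theorem card_galois : Nat.card (Concept (Fin 12) (Fin 12) galoisOrthogonal) = 168 := by
  let F : {n // n ∈ (Finset.range (2 ^ 12)).filter fun n => isGaloisExtent n = true} →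
      Concept (Fin 12) (Fin 12) galoisOrthogonal := fun n =>
    ofIsExtent _ {v : Fin 12 | n.1.testBit v} ((isGaloisExtent_iff _).1 (Finset.mem_filter.1 n.2).2)
  have hF : Function.Bijective F := by
    constructor
    · intro a b hab
      refine Subtype.ext (Nat.eq_of_testBit_eq fun i => ?_)
      have ha := Finset.mem_range.1 (Finset.mem_filter.1 a.2).1
      have hb := Finset.mem_range.1 (Finset.mem_filter.1 b.2).1
      by_cases hi : i < 12
      · have h1 : ⟨i, hi⟩ ∈ (F a).extent ↔ ⟨i, hi⟩ ∈ (F b).extent := by rw [hab]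
        exact Bool.eq_iff_iff.2 h1
      · have hp := Nat.pow_le_pow_right (n := 2) (by norm_num) (not_lt.1 hi)
        rw [Nat.testBit_lt_two_pow (ha.trans_le hp), Nat.testBit_lt_two_pow (hb.trans_le hp)]
    · intro c
      classical
      have hbit : {v : Fin 12 | (Nat.ofBits fun v => decide (v ∈ c.extent)).testBit v} = c.extent := by
        ext v
        change (Nat.ofBits fun v => decide (v ∈ c.extent)).testBit v = true ↔ _
        rw [Nat.testBit_ofBits_lt _ _ v.2]
        simp
      refine ⟨⟨Nat.ofBits fun v => decide (v ∈ c.extent), Finset.mem_filter.2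
        ⟨Finset.mem_range.2 (Nat.ofBits_lt_two_pow _), (isGaloisExtent_iff _).2 ?_⟩⟩, ?_⟩
      · rw [hbit]
        exact c.isExtent_extent
      · exact Concept.ext hbit
  rw [← Nat.card_eq_of_bijective F hF, Nat.card_eq_fintype_card, Fintype.card_coe,
    card_filter_isGaloisExtent]

/-- In a three-colouring of the Grötzsch graph, one could replace each colour of a `v_i` that is
the colour of the vertex `w` by the colour of `u_i`, and would obtain a two-colouring of the
`5`-cycle. -/
theorem not_colorable_three_grotzschGraph : ¬ grotzschGraph.Colorable 3 := by
  rintro ⟨c⟩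
  have huw : ∀ i, c (.inr (.inl i)) ≠ c (.inr (.inr ())) := fun i =>
    c.valid (by simp [grotzschGraph, mycielskian])
  have hvv : ∀ i, c (.inl i) ≠ c (.inl (i + 1)) := fun i => c.valid (by
    revert i; simp [grotzschGraph, mycielskian, SimpleGraph.cycleGraph_adj])
  have huv : ∀ i, c (.inr (.inl i)) ≠ c (.inl (i + 1)) := fun i => c.valid (by
    revert i; simp [grotzschGraph, mycielskian, SimpleGraph.cycleGraph_adj])
  have hvu : ∀ i, c (.inl i) ≠ c (.inr (.inl (i + 1))) := fun i => c.valid (by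
    revert i; simp [grotzschGraph, mycielskian, SimpleGraph.cycleGraph_adj])
  obtain ⟨d, hd⟩ : ∃ d : Fin 5 → Fin 3, ∀ i, d i ≠ c (.inr (.inr ())) ∧ d i ≠ d (i + 1) := by
    refine ⟨fun i => if c (.inl i) = c (.inr (.inr ())) then c (.inr (.inl i)) else c (.inl i),
      fun i => ?_⟩
    have := huw i; have := huw (i + 1); have := hvv i; have := huv i; have := hvu i
    constructor <;> grind
  have h0 := hd 0; have h1 := hd 1; have h2 := hd 2; have h3 := hd 3; have h4 := hd 4
  simp only [Fin.isValue, zero_add, Fin.reduceAdd] at h0 h1 h2 h3 h4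
  omega

/-- The vertices of the Grötzsch graph among the twelve vertices of the directed graph. -/
def grotzschVertex : Fin 5 ⊕ Fin 5 ⊕ Unit → Fin 12
  | .inl i => i.castLE (by norm_num)
  | .inr (.inl i) => (i.natAdd 5).castLE (by norm_num)
  | .inr (.inr _) => 10

theorem grotzschVertex_injective : Function.Injective grotzschVertex := by
  unfold Function.Injective; decide

theorem range_grotzschVertex : Set.range grotzschVertex = {11}ᶜ := by
  ext v
  revert v
  simp only [Set.mem_range, Set.mem_compl_iff, Set.mem_singleton_iff]
  decide

theorem grotzschGraph_adj_iff (a b : Fin 5 ⊕ Fin 5 ⊕ Unit) : grotzschGraph.Adj a b ↔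
    a ≠ b ∧ (galoisRel (grotzschVertex a) (grotzschVertex b) ∨
      galoisRel (grotzschVertex b) (grotzschVertex a)) := by
  rw [grotzschGraph, mycielskian, SimpleGraph.fromRel_adj]
  refine and_congr_right fun _ => ?_
  rcases a with i | i | ⟨⟩ <;> rcases b with j | j | ⟨⟩ <;>
    simp only [SimpleGraph.cycleGraph_adj] <;> decide +kernel +revert

theorem grotzschGraph_cliqueFree_three : grotzschGraph.CliqueFree 3 := by
  -- The vertex `11` must be excluded, as `2`, `11`, `1` form a triangle.
  have key : ∀ x y z : Fin 12, x ≠ 11 → y ≠ 11 → z ≠ 11 → x ≠ y → x ≠ z → y ≠ z →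
      (galoisRel x y ∨ galoisRel y x) → (galoisRel x z ∨ galoisRel z x) →
      ¬ (galoisRel y z ∨ galoisRel z y) := by decide +kernel
  have hne : ∀ a, grotzschVertex a ≠ 11 := by decide
  intro s hs
  obtain ⟨a, b, c, hab, hac, hbc, -⟩ := SimpleGraph.is3Clique_iff.1 hs
  rw [grotzschGraph_adj_iff, ← grotzschVertex_injective.ne_iff] at hab hac hbc
  exact key _ _ _ (hne a) (hne b) (hne c) hab.1 hac.1 hbc.1 hab.2 hac.2 hbc.2

theorem vertexSet_galois :
    (canonicalJoinComplex (Concept (Fin 12) (Fin 12) galoisOrthogonal)).vertexSet =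
      Set.range (ofObject galoisOrthogonal) :=
  vertexSet_concept (fun _ => .inl rfl) isTwoAcyclicFactorizationSystem_galoisRel
    galoisOrthogonal_iff

theorem ofObject_galois_injective : Function.Injective (ofObject galoisOrthogonal) :=
  ofObject_injective (fun _ => .inl rfl) isTwoAcyclicFactorizationSystem_galoisRel
    galoisOrthogonal_iff

theorem nonempty_oneSkeleton_induce_galois_iso :
    Nonempty (((canonicalJoinComplex (Concept (Fin 12) (Fin 12) galoisOrthogonal)).induce
      ((canonicalJoinComplex (Concept (Fin 12) (Fin 12) galoisOrthogonal)).vertexSet \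
        {ofObject galoisOrthogonal 11})).oneSkeleton ≃g grotzschGraphᶜ) := by
  set C := canonicalJoinComplex (Concept (Fin 12) (Fin 12) galoisOrthogonal) with hC
  set X := C.vertexSet \ {ofObject galoisOrthogonal 11} with hX
  have hmem : ∀ a, ofObject galoisOrthogonal (grotzschVertex a) ∈ (C.induce X).vertexSet := by
    intro a
    have ha : grotzschVertex a ∈ ({11}ᶜ : Set (Fin 12)) := range_grotzschVertex ▸ ⟨a, rfl⟩
    have hv : ofObject galoisOrthogonal (grotzschVertex a) ∈ C.vertexSet :=
      vertexSet_galois ▸ ⟨_, rfl⟩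
    exact (C.mem_vertexSet_induce X _).2 ⟨hv, hv, fun h => ha (ofObject_galois_injective h)⟩
  let g : Fin 5 ⊕ Fin 5 ⊕ Unit → (C.induce X).vertexSet := fun a => ⟨_, hmem a⟩
  have hg : Function.Bijective g := by
    refine ⟨fun a b hab => grotzschVertex_injective
      (ofObject_galois_injective (congrArg Subtype.val hab)), ?_⟩
    rintro ⟨x, hx⟩
    obtain ⟨hxC, -, hx11⟩ := (C.mem_vertexSet_induce X x).1 hx
    rw [hC, vertexSet_galois] at hxC
    obtain ⟨v, rfl⟩ := hxC
    have hv : v ∈ Set.range grotzschVertex := by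
      rw [range_grotzschVertex]
      rintro rfl
      exact hx11 rfl
    obtain ⟨a, rfl⟩ := hv
    exact ⟨a, rfl⟩
  refine ⟨RelIso.symm ⟨Equiv.ofBijective g hg, fun {a b} => ?_⟩⟩
  change (C.induce X).oneSkeleton.Adj (g a) (g b) ↔ _
  rw [C.oneSkeleton_induce_adj_iff, oneSkeleton_concept_adj_iff (fun _ => .inl rfl)
    isTwoAcyclicFactorizationSystem_galoisRel galoisOrthogonal_iff _ _ rfl rfl,
    SimpleGraph.compl_adj, grotzschGraph_adj_iff, grotzschVertex_injective.ne_iff,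
    galoisOrthogonal_iff, galoisOrthogonal_iff]
  tauto

end Grotzsch

theorem IsCanonicalJoinGraph.of_iso {α β : Type*} {G : SimpleGraph α} {H : SimpleGraph β}
    (h : IsCanonicalJoinGraph.{u} G) (e : G ≃g H) : IsCanonicalJoinGraph.{u} H := by
  obtain ⟨M, i, hf, hM, ⟨e'⟩⟩ := h
  exact ⟨M, i, hf, hM, ⟨e.symm.trans e'⟩⟩

theorem not_isCanonicalJoinGraph_compl_grotzschGraph :
    ¬ IsCanonicalJoinGraph.{u} grotzschGraphᶜ := fun h =>
  not_colorable_three_grotzschGraph (h.compl_colorable_three grotzschGraph_cliqueFree_three)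

end CanonicalJoin

theorem mainTheorem7 :
    (∃ (L : Type) (_ : Lattice L),
      Nonempty (L ≃o CanonicalJoin.MaximalOrthogonalPairs
        fun x y => (x, y) ∈ CanonicalJoin.galoisArrows) ∧
      Finite L ∧
      CanonicalJoin.IsSemidistributive L ∧
      CanonicalJoin.IsExtremal L ∧
      Nat.card L = 168 ∧
      ∃ t ∈ (CanonicalJoin.canonicalJoinComplex L).vertexSet,
        ∃ K : PreAbstractSimplicialComplex L,
          K = (CanonicalJoin.canonicalJoinComplex L).induce
            ((CanonicalJoin.canonicalJoinComplex L).vertexSet \ {t}) ∧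
          Nonempty (K.oneSkeleton ≃g CanonicalJoin.grotzschGraphᶜ) ∧
          ¬ CanonicalJoin.IsCanonicalJoinGraph.{u} K.oneSkeleton ∧
          ¬ CanonicalJoin.IsCanonicalJoinComplex.{u} K) ∧
    (∀ (V : Type v) (G : SimpleGraph V), G.CliqueFree 3 →
      (CanonicalJoin.AdmitsTwoAcyclicFactorizationSystem G ↔ G.Colorable 3)) := by
  refine ⟨⟨Concept (Fin 12) (Fin 12) CanonicalJoin.galoisOrthogonal, inferInstance,
    ⟨OrderIso.refl _⟩, Finite.of_injective _ Concept.extent_injective,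
    CanonicalJoin.isSemidistributive_concept (fun _ => .inl rfl)
      CanonicalJoin.isTwoAcyclicFactorizationSystem_galoisRel CanonicalJoin.galoisOrthogonal_iff,
    CanonicalJoin.isExtremal_galois, CanonicalJoin.card_galois,
    Concept.ofObject CanonicalJoin.galoisOrthogonal 11,
    CanonicalJoin.vertexSet_galois ▸ ⟨11, rfl⟩, _, rfl, ?_⟩, fun V G hG =>
    ⟨fun h => h.colorable_three hG,
      CanonicalJoin.admitsTwoAcyclicFactorizationSystem_of_colorable_three⟩⟩
  have hiso := CanonicalJoin.nonempty_oneSkeleton_induce_galois_iso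
  have hgraph := fun h => hiso.elim fun e =>
    CanonicalJoin.not_isCanonicalJoinGraph_compl_grotzschGraph
      (CanonicalJoin.IsCanonicalJoinGraph.of_iso h e)
  exact ⟨hiso, hgraph, fun h => hgraph h.isCanonicalJoinGraph⟩
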